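/- Let $G$ be a countably infinite amenable group, and let $(F_n)_{n\ge 0}$ be any Følner sequence of $G$, i.e. a sequence of nonempty finite subsets of $G$ with $|KF_n \,\triangle\, F_n|/|F_n| \to 0$ for every nonempty finite $K \subset G$. A $G$-subshift is a closed subset $X$ of $\mathcal{A}^G$ (product topology, $\mathcal{A}$ a finite discrete alphabet) that is invariant under the shift action $(\sigma^g x)(h) = x(hg)$; write $T$ for the restriction of $\sigma$ to $X$. A factor map between $G$-subshifts is a continuous surjection commuting with the shift actions. The topological entropy of $(X,T)$ is $$h(X,T) = \sup_{\mathcal{U}} \limsup_{n\to\infty} \frac{1}{|F_n|} \log N\Bigl(\bigvee_{g \in F_n} T^{g^{-1}}\mathcal{U}\Bigr),$$ where $\mathcal{U}$ ranges over the finite open covers of $X$ and $N(\mathcal{V})$ is the minimal cardinality of a subcover of $\mathcal{V}$ (the upper limit is in fact a limit, and $h(X,T)$ does not depend on the Følner sequence). Let $(X,T)$ be any $G$-subshift, and let $\mathcal{H}_{sub}(X)$ be the set of all $r \in \mathbb{R}$ such that there exist a $G$-subshift $(Z,R)$ (over some finite alphabet) with $h(Z,R) = r$ and a factor map from $(X,T)$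 onto $(Z,R)$. Then $\mathcal{H}_{sub}(X)$ is a dense subset of the interval $[0,h(X,T)]$; that is, $\mathcal{H}_{sub}(X) \subset [0,h(X,T)] \subset \overline{\mathcal{H}_{sub}(X)}$. -/

import Mathlib

open Filter Topology
open scoped Pointwise symmDiff

open scoped Classical in
/-- A sequence of (nonempty) finite subsets of `G` is a Følner sequence if
`|K Fₙ ∆ Fₙ| / |Fₙ| → 0` for each nonempty finite `K ⊆ G`. A countable group is amenable
exactly when it has such a sequence. -/
structure IsFolnerSeq {G : Type*} [Group G] (F : ℕ → Finset G) : Prop where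
  nonempty : ∀ n, (F n).Nonempty
  tendsto : ∀ K : Finset G, K.Nonempty →
    Tendsto (fun n => (((K * F n) ∆ F n).card : ℝ) / ((F n).card : ℝ)) atTop (𝓝 0)

/-! ### Topological entropy of an action of `G` -/

/-- Finite open covers of `X`. -/
structure IsFiniteOpenCover {X : Type*} [TopologicalSpace X] (𝒰 : Set (Set X)) : Prop where
  finite : 𝒰.Finite
  isOpen : ∀ U ∈ 𝒰, IsOpen U
  sUnion_eq : ⋃₀ 𝒰 = Set.univ

/-- The join `⋁_{g ∈ F} T^{g⁻¹} 𝒰`: its members are the sets `⋂_{g ∈ F} T^{g⁻¹} U_g` with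
`U_g ∈ 𝒰`, where `T^{g⁻¹} U` is the preimage of `U` under `T^g`. -/
def coverJoin {G X : Type*} [Group G] [MulAction G X] (𝒰 : Set (Set X)) (F : Finset G) :
    Set (Set X) :=
  {V | ∃ c : G → Set X, (∀ g ∈ F, c g ∈ 𝒰) ∧ V = ⋂ g ∈ F, (fun x : X => g • x) ⁻¹' c g}

/-- The minimal cardinality of a subfamily of `𝒱` that covers `X`. -/
noncomputable def minSubcover {X : Type*} (𝒱 : Set (Set X)) : ℕ :=
  sInf {k : ℕ | ∃ s : Finset (Set X), (s : Set (Set X)) ⊆ 𝒱 ∧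
    ⋃₀ (s : Set (Set X)) = Set.univ ∧ s.card = k}

/-- The entropy of the action relative to the cover `𝒰`, along the sequence `F`. The upper limit
is the limit whenever the latter exists. Here `log 0 = ⊥`, which occurs only if `X` is empty. -/
noncomputable def coverEntropy {G X : Type*} [Group G] [MulAction G X] (F : ℕ → Finset G)
    (𝒰 : Set (Set X)) : EReal :=
  limsup (fun n => ENNReal.log (minSubcover (coverJoin 𝒰 (F n)) : ENNReal) /
    ((F n).card : EReal)) atTop

/-- Topological entropy: the supremum of the entropies relative to finite open covers. -/
noncomputable def topEntropy {G : Type*} [Group G] (F : ℕ → Finset G)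
    (X : Type*) [TopologicalSpace X] [MulAction G X] : EReal :=
  ⨆ (𝒰 : Set (Set X)) (_ : IsFiniteOpenCover 𝒰), coverEntropy F 𝒰

/-- A factor map of `G`-systems: a continuous equivariant surjection. -/
structure IsFactorMap (G : Type*) {X Y : Type*} [Group G] [TopologicalSpace X] [MulAction G X]
    [TopologicalSpace Y] [MulAction G Y] (φ : X → Y) : Prop where
  continuous : Continuous φ
  surjective : Function.Surjective φ
  map_smul : ∀ (g : G) (x : X), φ (g • x) = g • φ x

/-! ### Subshifts -/

/-- The shift `(σ^g x)(h) = x(hg)` on the full shift. -/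
def rightShift {G A : Type*} [Group G] (g : G) (x : G → A) : G → A := fun h => x (h * g)

/-- A `G`-subshift over the alphabet `A`: a closed shift-invariant subset of the full shift
`G → A` (with the product topology). -/
structure GSubshift (G A : Type*) [Group G] [TopologicalSpace A] where
  carrier : Set (G → A)
  isClosed : IsClosed carrier
  shift_mem : ∀ (g : G), ∀ x ∈ carrier, rightShift g x ∈ carrier

/-- The shift action of `G` on a subshift. -/
instance GSubshift.instMulAction {G A : Type*} [Group G] [TopologicalSpace A]
    (X : GSubshift G A) : MulAction G X.carrier where
  smul g x := ⟨rightShift g x.1, X.shift_mem g x.1 x.2⟩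
  one_smul x := Subtype.ext (funext fun h => congrArg x.1 (mul_one h))
  mul_smul a b x := Subtype.ext (funext fun h => congrArg x.1 (mul_assoc h a b).symm)

/-- The topological entropy of a subshift. -/
noncomputable def GSubshift.entropy {G A : Type*} [Group G] [TopologicalSpace A]
    (F : ℕ → Finset G) (X : GSubshift G A) : EReal :=
  topEntropy F X.carrier

/-- The set of real numbers that are the topological entropy of a `G`-subshift (over some finite
discrete alphabet) onto which `X` factors. -/
def GSubshift.factorEntropies {G A : Type*} [Group G] [TopologicalSpace A]
    (F : ℕ → Finset G) (X : GSubshift G A) : Set ℝ :=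
  {r | ∃ (B : Type) (_ : Finite B) (_ : TopologicalSpace B) (_ : DiscreteTopology B)
    (Z : GSubshift G B) (φ : X.carrier → Z.carrier),
    IsFactorMap G φ ∧ Z.entropy F = (r : EReal)}

/-! ### Counting sparse patterns -/

open scoped Classical in
-- A Chernoff bound: the sum of `t ^ |supp ψ|` over all `ψ` factors over `S` into the right-hand
-- side, and each sparse `ψ` contributes at least `t ^ L`.
theorem card_sparse_mul_pow_le {S Q : Type*} [Fintype S] [Fintype Q] (L : ℕ) {t : ℝ}
    (ht0 : 0 < t) (ht1 : t ≤ 1) :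
    ((Finset.univ.filter fun ψ : S → Option Q =>
      (Finset.univ.filter fun s => ψ s ≠ none).card ≤ L).card : ℝ) * t ^ L ≤
      (1 + Fintype.card Q * t) ^ Fintype.card S := by
  have key : ∑ ψ : S → Option Q, t ^ (Finset.univ.filter fun s => ψ s ≠ none).card =
      (1 + Fintype.card Q * t) ^ Fintype.card S := by
    have h1 := Finset.prod_univ_sum (fun _ : S => (Finset.univ : Finset (Option Q)))
      (fun _ o => if o = none then (1 : ℝ) else t)
    simp only [Fintype.sum_option, Finset.prod_const, Finset.card_univ, Fintype.piFinset_univ]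
      at h1
    simp only [if_true, reduceCtorEq, if_false, Finset.sum_const, Finset.card_univ,
      nsmul_eq_mul] at h1
    rw [h1]
    refine Finset.sum_congr rfl fun ψ _ => ?_
    rw [Finset.prod_ite]
    simp
  rw [← key, ← nsmul_eq_mul, ← Finset.sum_const]
  refine (Finset.sum_le_sum fun ψ hψ => ?_).trans
    (Finset.sum_le_univ_sum_of_nonneg fun ψ => by positivity)
  exact pow_le_pow_of_le_one ht0.le ht1 (Finset.mem_filter.1 hψ).2

/-- The exponential rate of the number of partial colourings with at most `q` colours whose
support has density at most `2 / M`. -/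
noncomputable def sparseRate (q M : ℕ) : ℝ := (1 + 2 * Real.log (q * M)) / M

-- Chernoff's bound at `t = 1 / (q M)`: the right-hand side becomes at most `exp (|S| / M)`, and `t
-- ^ (-L)` costs at most `2 |S| / M` times `log (q M)`. These are the two terms of `sparseRate`.
open scoped Classical in
theorem card_sparse_le {S Q : Type*} [Fintype S] [Fintype Q] {L q M : ℕ} (hM : 0 < M)
    (hq : 0 < q) (hQ : Fintype.card Q ≤ q) (hL : M * L ≤ 2 * Fintype.card S) :
    ((Finset.univ.filter fun ψ : S → Option Q =>
      (Finset.univ.filter fun s => ψ s ≠ none).card ≤ L).card : ℝ) ≤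
      Real.exp (sparseRate q M * Fintype.card S) := by
  have hM' : (0 : ℝ) < M := by exact_mod_cast hM
  have hq' : (0 : ℝ) < q := by exact_mod_cast hq
  have hqM : (1 : ℝ) ≤ q * M := by exact_mod_cast Nat.mul_pos hq hM
  have h := card_sparse_mul_pow_le (S := S) (Q := Q) L (t := ((q : ℝ) * M)⁻¹) (by positivity)
    (inv_le_one_of_one_le₀ hqM)
  rw [inv_pow, ← div_eq_mul_inv, div_le_iff₀ (by positivity)] at h
  refine h.trans ?_
  have h1 : (1 + Fintype.card Q * ((q : ℝ) * M)⁻¹) ^ Fintype.card S ≤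
      Real.exp (Fintype.card S / M) := by
    have : 1 + Fintype.card Q * ((q : ℝ) * M)⁻¹ ≤ Real.exp (1 / M) := by
      have h2 : (Fintype.card Q : ℝ) * ((q : ℝ) * M)⁻¹ ≤ 1 / M := by
        rw [← div_eq_mul_inv, div_le_div_iff₀ (by positivity) hM', one_mul]
        gcongr
      linarith [Real.add_one_le_exp (1 / (M : ℝ))]
    calc _ ≤ Real.exp (1 / M) ^ Fintype.card S := by gcongr
      _ = _ := by rw [← Real.exp_nat_mul]; congr 1; ring
  have h2 : ((q : ℝ) * M) ^ L ≤ Real.exp (2 * Fintype.card S / M * Real.log (q * M)) := by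
    rw [← Real.exp_log (show (0 : ℝ) < (q * M) ^ L by positivity), Real.log_pow]
    have : (L : ℝ) ≤ 2 * Fintype.card S / M := by
      rw [le_div_iff₀ hM']
      have : ((M * L : ℕ) : ℝ) ≤ ((2 * Fintype.card S : ℕ) : ℝ) := by exact_mod_cast hL
      push_cast at this
      linarith
    exact Real.exp_le_exp.2 (mul_le_mul_of_nonneg_right this (Real.log_nonneg hqM))
  calc _ ≤ Real.exp (Fintype.card S / M) *
        Real.exp (2 * Fintype.card S / M * Real.log (q * M)) := by gcongr
    _ = _ := by
      rw [← Real.exp_add, sparseRate]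
      congr 1
      ring

open scoped Classical in
/-- If `β` is determined by `α` together with a partial colouring of `S` whose support has
pairwise disjoint translates of `K`, then `β` takes few more values than `α`. -/
theorem ncard_range_le_of_sparse {G X P P' Q : Type*} [Group G] [Finite P] [Fintype Q]
    {α : X → P} {β : X → P'} {S K : Finset G} (hK : K.Nonempty)
    (hKS : (K * S).card ≤ 2 * S.card) {q : ℕ} (hq : 0 < q) (hQ : Fintype.card Q ≤ q)
    (ψ : X → S → Option Q)
    (hsep : ∀ x s s', ψ x s ≠ none → ψ x s' ≠ none → ∀ k ∈ K, ∀ k' ∈ K,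
      k * (s : G) = k' * s' → s = s')
    (hdet : ∀ x x', α x = α x' → ψ x = ψ x' → β x = β x') :
    ((Set.range β).ncard : ℝ) ≤
      (Set.range α).ncard * Real.exp (sparseRate q K.card * S.card) := by
  -- The disjoint translates `K s`, for `s` in the support, all lie in `K * S`, which has at most `2
  -- |S|` elements.
  set L : ℕ := 2 * S.card / K.card
  have hLs : ∀ x, (Finset.univ.filter fun s => ψ x s ≠ none).card ≤ L := by
    intro x
    rw [Nat.le_div_iff_mul_le hK.card_pos, mul_comm, ← Finset.card_product]
    refine le_trans ?_ hKS
    refine Finset.card_le_card_of_injOn (fun p => p.1 * (p.2 : G)) ?_ ?_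
    · rintro ⟨k, s⟩ h
      simp only [Finset.coe_product, Set.mem_prod, Finset.mem_coe] at h
      exact Finset.mul_mem_mul h.1 s.2
    · rintro ⟨k, s⟩ h ⟨k', s'⟩ h' e
      simp only [Finset.coe_product, Set.mem_prod, Finset.mem_coe, Finset.mem_filter,
        Finset.mem_univ, true_and] at h h' e
      have := hsep x s s' h.2 h'.2 k h.1 k' h'.1 e
      subst this
      simpa using e
  set R := Finset.univ.filter fun ψ : S → Option Q =>
      (Finset.univ.filter fun s => ψ s ≠ none).card ≤ L
  have hR : (R.card : ℝ) ≤ Real.exp (sparseRate q K.card * S.card) := by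
    have := card_sparse_le (S := S) (Q := Q) (L := L) hK.card_pos hq hQ
      (by rw [Fintype.card_coe]; exact Nat.mul_div_le _ _)
    rw [Fintype.card_coe] at this
    convert this
  have hfin : (Set.range α ×ˢ (R : Set (S → Option Q))).Finite := Set.toFinite _
  have hle : (Set.range β).ncard ≤ (Set.range α ×ˢ (R : Set (S → Option Q))).ncard := by
    have h1 : (Set.range fun x => (α x, ψ x)).ncard ≤ _ :=
      Set.ncard_le_ncard (t := Set.range α ×ˢ (R : Set (S → Option Q))) (by
        rintro _ ⟨x, rfl⟩
        exact ⟨⟨x, rfl⟩, by simpa [R] using hLs x⟩) hfin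
    refine le_trans ?_ h1
    have hex : ∀ p : Set.range fun x => (α x, ψ x), ∃ x, (α x, ψ x) = p := fun p => p.2
    choose c hc using hex
    have hsub : Set.range β ⊆ Set.range fun p => β (c p) := by
      rintro _ ⟨x, rfl⟩
      refine ⟨⟨_, x, rfl⟩, ?_⟩
      have := hc ⟨_, x, rfl⟩
      simp only [Prod.mk.injEq] at this
      exact hdet _ _ this.1 this.2
    have hf : (Set.range fun x => (α x, ψ x)).Finite := Set.toFinite _
    have := hf.to_subtype
    refine (Set.ncard_le_ncard hsub (Set.finite_range _)).trans ?_
    rw [← Set.image_univ]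
    refine (Set.ncard_image_le (Set.toFinite _)).trans ?_
    rw [Set.ncard_univ, Nat.card_coe_set_eq]
  rw [Set.ncard_prod, Set.ncard_coe_finset] at hle
  calc ((Set.range β).ncard : ℝ) ≤ (((Set.range α).ncard * R.card : ℕ) : ℝ) := by
        exact_mod_cast hle
    _ ≤ _ := by push_cast; exact mul_le_mul_of_nonneg_left hR (Nat.cast_nonneg _)

/-- In an infinite group there are finite sets much larger than the number of generators of a
subgroup containing them. -/
theorem exists_finset_subset_closure (G : Type*) [Group G] [Infinite G] (M : ℕ) :
    ∃ T W : Finset G, (W : Set G) ⊆ Subgroup.closure (T : Set G) ∧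
      M * (T.card + 1) ≤ W.card := by
  classical
  -- If some finite `T` generates an infinite subgroup, `T` stays fixed while `W` grows. Otherwise
  -- `G` is locally finite, and each new generator outside the current subgroup doubles `W`.
  by_cases hfg : ∃ T : Finset G, (Subgroup.closure (T : Set G) : Set G).Infinite
  · obtain ⟨T, hT⟩ := hfg
    obtain ⟨W, hW, hc⟩ := hT.exists_subset_card_eq (M * (T.card + 1))
    exact ⟨T, W, hW, hc.ge⟩
  push Not at hfg
  have h : ∀ r : ℕ, ∃ T W : Finset G, T.card ≤ r ∧
      (W : Set G) ⊆ Subgroup.closure (T : Set G) ∧ W.card = 2 ^ r := by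
    intro r
    induction r with
    | zero => exact ⟨∅, {1}, by simp, by simp, by simp⟩
    | succ r ih =>
      obtain ⟨T, W, hT, hW, hc⟩ := ih
      obtain ⟨t, ht⟩ := (Set.not_infinite.1 (by simpa using hfg T)).infinite_compl.nonempty
      have hsub : Subgroup.closure (T : Set G) ≤
          Subgroup.closure ((insert t T : Finset G) : Set G) :=
        Subgroup.closure_mono (by simp)
      refine ⟨insert t T, W ∪ W.image (· * t), (Finset.card_insert_le _ _).trans (by omega),
        ?_, ?_⟩
      · intro w hw
        simp only [Finset.coe_union, Finset.coe_image, Set.mem_union, Finset.mem_coe,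
          Set.mem_image] at hw
        rcases hw with hw | ⟨v, hv, rfl⟩
        · exact hsub (hW hw)
        · exact mul_mem (hsub (hW hv)) (Subgroup.subset_closure (by simp))
      · rw [Finset.card_union_of_disjoint, Finset.card_image_of_injective _
          (mul_left_injective t), hc, pow_succ]
        · ring
        · rw [Finset.disjoint_left]
          intro w hw hw'
          obtain ⟨v, hv, rfl⟩ := Finset.mem_image.1 hw'
          exact ht (by simpa using mul_mem (inv_mem (hW hv)) (hW hw))
  obtain ⟨r, hr⟩ : ∃ r : ℕ, M * (r + 1) ≤ 2 ^ r := by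
    -- Here `2 ^ r` is the cube of `2 ^ (M + 1) ≥ M + 2`, which beats the quadratic `M * (r + 1)`.
    refine ⟨(M + 1) * 3, ?_⟩
    have h2 : M + 2 ≤ 2 ^ (M + 1) := Nat.lt_two_pow_self
    have h3 := Nat.pow_le_pow_left h2 3
    rw [pow_mul]
    nlinarith [Nat.zero_le (M ^ 3), Nat.zero_le (M ^ 2)]
  obtain ⟨T, W, hT, hW, hc⟩ := h r
  exact ⟨T, W, hW, hc ▸ (Nat.mul_le_mul_left M (by omega)).trans hr⟩

/-! ### Entropy of subshifts by counting patterns -/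

theorem limsup_log_div_le {u v c : ℕ → ℕ} (hc : ∀ n, 0 < c n) (ε : ℝ)
    (h : ∀ᶠ n in atTop, (u n : ℝ) ≤ v n * Real.exp (ε * c n)) :
    limsup (fun n => ENNReal.log (u n : ENNReal) / (c n : EReal)) atTop ≤
      limsup (fun n => ENNReal.log (v n : ENNReal) / (c n : EReal)) atTop + (ε : EReal) := by
  have hlim : limsup (fun _ : ℕ => (ε : EReal)) atTop = (ε : EReal) := limsup_const _
  refine le_trans ?_ ((EReal.limsup_add_le (u := fun n =>
    ENNReal.log (v n : ENNReal) / (c n : EReal)) (v := fun _ => (ε : EReal)) (f := atTop)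
    (Or.inr (by rw [hlim]; exact EReal.coe_ne_top ε))
    (Or.inr (by rw [hlim]; exact EReal.coe_ne_bot ε))).trans_eq (by rw [hlim]))
  refine limsup_le_limsup (h.mono fun n hn => ?_)
  have hc' : (0 : ℝ) < c n := by exact_mod_cast hc n
  have h1 : (u n : ENNReal) ≤ v n * ENNReal.ofReal (Real.exp (ε * c n)) := by
    have := ENNReal.ofReal_le_ofReal hn
    rwa [ENNReal.ofReal_mul (Nat.cast_nonneg _), ENNReal.ofReal_natCast,
      ENNReal.ofReal_natCast] at this
  have h2 := ENNReal.log_le_log h1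
  rw [ENNReal.log_mul_add, ENNReal.log_ofReal_of_pos (Real.exp_pos _), Real.log_exp] at h2
  refine (EReal.div_le_div_right_of_nonneg (by positivity) h2).trans_eq ?_
  rw [EReal.add_div_of_nonneg_right (by positivity)]
  congr 1
  change ((ε * c n : ℝ) : EReal) / ((c n : ℝ) : EReal) = _
  rw [← EReal.coe_div, mul_div_cancel_right₀ _ hc'.ne']

theorem EReal.le_of_forall_pos_real_le_add {x y : EReal}
    (h : ∀ δ : ℝ, 0 < δ → x ≤ y + (δ : EReal)) : x ≤ y := by
  induction y with
  | bot => simpa using h 1 one_pos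
  | top => exact le_top
  | coe y =>
    refine EReal.le_of_forall_lt_iff_le.1 fun z hz => ?_
    have hz' : y < z := EReal.coe_lt_coe_iff.1 hz
    refine (h (z - y) (by linarith)).trans_eq ?_
    rw [← EReal.coe_add]
    congr 1
    ring

/-- The number of patterns of `Z` on the finite set `S`. -/
noncomputable def patternCount {G B : Type*} (Z : Set (G → B)) (S : Finset G) : ℕ :=
  ((fun (z : G → B) (g : S) => z g) '' Z).ncard

theorem coverJoin_finite {G X : Type*} [Group G] [MulAction G X] {𝒰 : Set (Set X)}
    (h𝒰 : 𝒰.Finite) (F : Finset G) : (coverJoin 𝒰 F).Finite := by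
  classical
  have := h𝒰.to_subtype
  refine (Set.finite_range fun c : F → 𝒰 =>
    ⋂ g : F, (fun x : X => (g : G) • x) ⁻¹' (c g : Set X)).subset ?_
  rintro _ ⟨c, hc, rfl⟩
  exact ⟨fun g => ⟨c g, hc g g.2⟩, by simp [Set.iInter_subtype]⟩

theorem sUnion_coverJoin {G X : Type*} [Group G] [MulAction G X] {𝒰 : Set (Set X)}
    (h𝒰 : ⋃₀ 𝒰 = Set.univ) (F : Finset G) : ⋃₀ coverJoin 𝒰 F = Set.univ := by
  refine Set.eq_univ_of_forall fun x => ?_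
  have h : ∀ g : G, ∃ U ∈ 𝒰, g • x ∈ U := fun g => by
    have : g • x ∈ ⋃₀ 𝒰 := h𝒰 ▸ Set.mem_univ _
    simpa using this
  choose c hc hxc using h
  exact ⟨_, ⟨c, fun g _ => hc g, rfl⟩, by simpa using fun g _ => hxc g⟩

theorem exists_card_eq_minSubcover {X : Type*} {𝒱 : Set (Set X)} (hfin : 𝒱.Finite)
    (hcov : ⋃₀ 𝒱 = Set.univ) :
    ∃ s : Finset (Set X), (s : Set (Set X)) ⊆ 𝒱 ∧ ⋃₀ (s : Set (Set X)) = Set.univ ∧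
      s.card = minSubcover 𝒱 :=
  Nat.sInf_mem (s := {k : ℕ | ∃ s : Finset (Set X), (s : Set (Set X)) ⊆ 𝒱 ∧
    ⋃₀ (s : Set (Set X)) = Set.univ ∧ s.card = k})
    ⟨_, hfin.toFinset, by simp, by simpa using hcov, rfl⟩

theorem minSubcover_le {X : Type*} {𝒱 : Set (Set X)} {s : Finset (Set X)}
    (hs : (s : Set (Set X)) ⊆ 𝒱) (hcov : ⋃₀ (s : Set (Set X)) = Set.univ) :
    minSubcover 𝒱 ≤ s.card :=
  Nat.sInf_le ⟨s, hs, hcov, rfl⟩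

/-- If `f` is constant on the members of a finite cover `𝒱`, then it takes at most
`minSubcover 𝒱` values. -/
theorem ncard_range_le_minSubcover {X P : Type*} {𝒱 : Set (Set X)} (hfin : 𝒱.Finite)
    (hcov : ⋃₀ 𝒱 = Set.univ) (f : X → P)
    (hf : ∀ V ∈ 𝒱, ∀ x ∈ V, ∀ y ∈ V, f x = f y) :
    (Set.range f).ncard ≤ minSubcover 𝒱 := by
  classical
  obtain ⟨s, hs, hsc, hcard⟩ := exists_card_eq_minSubcover hfin hcov
  rw [← hcard, ← Set.ncard_coe_finset]
  have h : ∀ p : Set.range f, ∃ V ∈ s, ∃ x ∈ V, f x = p := by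
    rintro ⟨_, x, rfl⟩
    have : x ∈ ⋃₀ (s : Set (Set X)) := hsc ▸ Set.mem_univ x
    obtain ⟨V, hV, hx⟩ := this
    exact ⟨V, hV, x, hx, rfl⟩
  choose V hV x hx hfx using h
  refine Set.ncard_le_ncard_of_injOn (fun p => if hp : p ∈ Set.range f then V ⟨p, hp⟩ else ∅)
    ?_ ?_ s.finite_toSet
  · intro p hp
    simpa [hp] using hV ⟨p, hp⟩
  · intro p hp p' hp' e
    simp only [hp, hp', dif_pos] at e
    exact (hfx ⟨p, hp⟩).symm.trans ((hf _ (hs (hV ⟨p, hp⟩)) _ (hx _) _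
      (e ▸ hx ⟨p', hp'⟩)).trans (hfx ⟨p', hp'⟩))

/-- If each fibre of `f` lies in a member of `𝒱`, then `minSubcover 𝒱` is at most the number of
values of `f`. -/
theorem minSubcover_le_ncard_range {X P : Type*} {𝒱 : Set (Set X)} (f : X → P)
    (hfin : (Set.range f).Finite) (hf : ∀ x, ∃ V ∈ 𝒱, ∀ y, f y = f x → y ∈ V) :
    minSubcover 𝒱 ≤ (Set.range f).ncard := by
  classical
  have h : ∀ p : Set.range f, ∃ V ∈ 𝒱, ∀ y, f y = p → y ∈ V := by
    rintro ⟨_, x, rfl⟩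
    exact hf x
  choose V hV hVy using h
  have := hfin.fintype
  refine (minSubcover_le (s := Finset.univ.image V) (by simpa [Set.range_subset_iff] using hV)
    ?_).trans (Finset.card_image_le.trans ?_)
  · refine Set.eq_univ_of_forall fun y => ⟨V ⟨f y, y, rfl⟩, by simp, hVy _ _ rfl⟩
  · rw [Finset.card_univ, ← Nat.card_eq_fintype_card, Nat.card_coe_set_eq]

theorem GSubshift.smul_apply {G A : Type*} [Group G] [TopologicalSpace A] (X : GSubshift G A)
    (g h : G) (x : X.carrier) : (g • x).1 h = x.1 (h * g) := rfl

/-- A neighbourhood of a point in a set of configurations contains a cylinder. -/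
theorem exists_cylinder_subset {G A : Type*} [TopologicalSpace A] [DiscreteTopology A]
    {Z : Set (G → A)} {U : Set Z} (hU : IsOpen U) {x : Z} (hx : x ∈ U) :
    ∃ W : Finset G, ∀ y : Z, (∀ w ∈ W, y.1 w = x.1 w) → y ∈ U := by
  obtain ⟨O, hO, rfl⟩ := isOpen_induced_iff.1 hU
  obtain ⟨W, u, hu, hsub⟩ := isOpen_pi_iff.1 hO x.1 hx
  refine ⟨W, fun y hy => hsub fun w hw => ?_⟩
  rw [hy w hw]
  exact (hu w hw).2

theorem isOpen_cylinder {G A : Type*} [TopologicalSpace A] [DiscreteTopology A]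
    {Z : Set (G → A)} (W : Finset G) (x : Z) :
    IsOpen {y : Z | ∀ w ∈ W, y.1 w = x.1 w} := by
  have : {y : Z | ∀ w ∈ W, y.1 w = x.1 w} = ⋂ w ∈ W, (fun y : Z => y.1 w) ⁻¹' {x.1 w} := by
    ext y; simp
  rw [this]
  exact isOpen_biInter_finset fun w _ => (isOpen_discrete _).preimage
    ((continuous_apply w).comp continuous_subtype_val)

instance GSubshift.compactSpace {G A : Type*} [Group G] [TopologicalSpace A] [Finite A]
    (X : GSubshift G A) : CompactSpace X.carrier :=
  isCompact_iff_compactSpace.1 X.isClosed.isCompact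

/-- Every open cover of a subshift is refined by the partition into patterns on some finite
set. -/
theorem exists_cylinder_refinement {G A : Type*} [Group G] [TopologicalSpace A]
    [DiscreteTopology A] [Finite A] (Z : GSubshift G A) {𝒰 : Set (Set Z.carrier)}
    (h𝒰 : IsFiniteOpenCover 𝒰) :
    ∃ W : Finset G, ∀ x : Z.carrier, ∃ U ∈ 𝒰, ∀ y : Z.carrier,
      (∀ w ∈ W, y.1 w = x.1 w) → y ∈ U := by
  classical
  have h : ∀ x : Z.carrier, ∃ W : Finset G, ∃ U ∈ 𝒰, ∀ y : Z.carrier,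
      (∀ w ∈ W, y.1 w = x.1 w) → y ∈ U := by
    intro x
    have : x ∈ ⋃₀ 𝒰 := h𝒰.sUnion_eq ▸ Set.mem_univ _
    obtain ⟨U, hU, hx⟩ := this
    obtain ⟨W, hW⟩ := exists_cylinder_subset (h𝒰.isOpen U hU) hx
    exact ⟨W, U, hU, hW⟩
  choose W U hU hWU using h
  obtain ⟨t, ht⟩ := isCompact_univ.elim_finite_subcover
    (fun x : Z.carrier => {y : Z.carrier | ∀ w ∈ W x, y.1 w = x.1 w})
    (fun x => isOpen_cylinder (W x) x)
    (fun x _ => Set.mem_iUnion.2 ⟨x, by simp⟩)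
  refine ⟨t.biUnion W, fun x => ?_⟩
  obtain ⟨z, hz, hxz⟩ := Set.mem_iUnion₂.1 (ht (Set.mem_univ x))
  exact ⟨U z, hU z, fun y hy => hWU z y fun w hw =>
    (hy w (Finset.mem_biUnion.2 ⟨z, hz, hw⟩)).trans (hxz w hw)⟩

open scoped Classical in
/-- Enlarging the window from `S` to `S'` multiplies the number of patterns by at most
`|B| ^ |S' \ S|`. -/
theorem patternCount_le_mul_pow {G B : Type*} [Finite B] (Z : Set (G → B))
    (S S' : Finset G) :
    patternCount Z S' ≤ patternCount Z S * Nat.card B ^ (S' \ S).card := by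
  let Φ : (S → B) × ((S' \ S : Finset G) → B) → S' → B := fun p g =>
    if h : (g : G) ∈ S then p.1 ⟨g, h⟩ else p.2 ⟨g, Finset.mem_sdiff.2 ⟨g.2, h⟩⟩
  have hsub : (fun (z : G → B) (g : S') => z g) '' Z ⊆
      Φ '' (((fun (z : G → B) (g : S) => z g) '' Z) ×ˢ Set.univ) := by
    rintro _ ⟨z, hz, rfl⟩
    refine ⟨(fun g => z g, fun g => z g), ⟨⟨z, hz, rfl⟩, trivial⟩, ?_⟩
    funext g
    simp [Φ]
  refine (Set.ncard_le_ncard hsub (Set.toFinite _)).trans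
    ((Set.ncard_image_le (Set.toFinite _)).trans_eq ?_)
  rw [Set.ncard_prod, Set.ncard_univ, Nat.card_fun, Nat.card_eq_finsetCard, patternCount]

theorem IsFolnerSeq.card_pos {G : Type*} [Group G] {F : ℕ → Finset G} (hF : IsFolnerSeq F)
    (n : ℕ) : 0 < (F n).card := (hF.nonempty n).card_pos

open scoped Classical in
theorem IsFolnerSeq.eventually_card_sdiff_le {G : Type*} [Group G] {F : ℕ → Finset G}
    (hF : IsFolnerSeq F) (K : Finset G) {δ : ℝ} (hδ : 0 < δ) :
    ∀ᶠ n in atTop, (((K * F n) \ F n).card : ℝ) ≤ δ * (F n).card := by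
  rcases K.eq_empty_or_nonempty with rfl | hK
  · refine Eventually.of_forall fun n => ?_
    simp only [Finset.empty_mul, Finset.empty_sdiff, Finset.card_empty, Nat.cast_zero]
    positivity
  filter_upwards [(hF.tendsto K hK).eventually_lt_const hδ] with n hn
  have hc : (0 : ℝ) < (F n).card := by exact_mod_cast hF.card_pos n
  rw [div_lt_iff₀ hc] at hn
  refine le_trans ?_ hn.le
  exact_mod_cast Finset.card_le_card (Finset.subset_union_left)

open scoped Classical in
theorem IsFolnerSeq.eventually_card_mul_le {G : Type*} [Group G] {F : ℕ → Finset G}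
    (hF : IsFolnerSeq F) (K : Finset G) :
    ∀ᶠ n in atTop, (K * F n).card ≤ 2 * (F n).card := by
  filter_upwards [hF.eventually_card_sdiff_le K one_pos] with n hn
  rw [one_mul, Nat.cast_le] at hn
  have := Finset.card_le_card (show K * F n ⊆ ((K * F n) \ F n) ∪ F n by simp)
  have := this.trans (Finset.card_union_le _ _)
  omega

/-- A cover is refined by patterns on some `W`, so its join over `F n` is refined by patterns on `W
* F n`; the Følner property makes the extra coordinates negligible. Conversely, the cover by
cylinders at the identity already separates all patterns on `F n`. -/
theorem GSubshift.entropy_eq_limsup {G B : Type*} [Group G] [TopologicalSpace B]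
    [DiscreteTopology B] [Finite B] {F : ℕ → Finset G} (hF : IsFolnerSeq F)
    (Z : GSubshift G B) :
    Z.entropy F = limsup (fun n => ENNReal.log (patternCount Z.carrier (F n) : ENNReal) /
      ((F n).card : EReal)) atTop := by
  classical
  have hrange : ∀ S : Finset G, patternCount Z.carrier S =
      (Set.range fun (z : Z.carrier) (g : S) => z.1 g).ncard := fun S => by
    rw [patternCount, Set.image_eq_range]
  apply le_antisymm
  · refine iSup₂_le fun 𝒰 h𝒰 => ?_
    obtain ⟨W, hW⟩ := exists_cylinder_refinement Z h𝒰
    have hbound : ∀ S : Finset G, minSubcover (coverJoin 𝒰 S) ≤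
        patternCount Z.carrier (W * S) := by
      intro S
      rw [hrange]
      refine minSubcover_le_ncard_range _ (Set.toFinite _) fun x => ?_
      choose U hU hUy using hW
      refine ⟨_, ⟨fun g => U (g • x), fun g _ => hU _, rfl⟩, fun y hy => ?_⟩
      simp only [Set.mem_iInter, Set.mem_preimage]
      intro g hg
      refine hUy _ _ fun w hw => ?_
      exact congrFun hy ⟨w * g, Finset.mul_mem_mul hw hg⟩
    refine EReal.le_of_forall_pos_real_le_add fun δ hδ => ?_
    refine limsup_log_div_le hF.card_pos δ ?_
    have hlog : 0 ≤ Real.log (Nat.card B) := Real.log_natCast_nonneg _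
    -- The `+ 1` keeps the denominator positive for a one-letter alphabet.
    have hδ' : 0 < δ / (Real.log (Nat.card B) + 1) := by positivity
    filter_upwards [hF.eventually_card_sdiff_le W hδ'] with n hn
    rcases isEmpty_or_nonempty Z.carrier with hZ | hZ
    · have h0 : minSubcover (coverJoin 𝒰 (F n)) = 0 :=
        Nat.le_zero.1 (minSubcover_le (s := ∅) (by simp) (Set.eq_univ_of_forall isEmptyElim))
      rw [h0, Nat.cast_zero]
      positivity
    have hB : (0 : ℝ) < Nat.card B := by
      have : Nonempty B := ⟨hZ.some.1 1⟩
      exact_mod_cast Nat.card_pos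
    have h1 : (minSubcover (coverJoin 𝒰 (F n)) : ℝ) ≤
        patternCount Z.carrier (F n) * (Nat.card B : ℝ) ^ ((W * F n) \ F n).card := by
      exact_mod_cast (hbound _).trans (patternCount_le_mul_pow _ (F n) _)
    refine h1.trans (mul_le_mul_of_nonneg_left ?_ (Nat.cast_nonneg _))
    rw [← Real.exp_log (pow_pos hB _), Real.log_pow, Real.exp_le_exp]
    calc (((W * F n) \ F n).card : ℝ) * Real.log (Nat.card B)
        ≤ δ / (Real.log (Nat.card B) + 1) * (F n).card * (Real.log (Nat.card B) + 1) :=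
          mul_le_mul hn (by linarith) hlog (by positivity)
      _ = δ * (F n).card := by field_simp
  · let cyl : B → Set Z.carrier := fun b => {z | z.1 1 = b}
    have hcov : IsFiniteOpenCover (Set.range cyl) := by
      refine ⟨Set.finite_range _, ?_, ?_⟩
      · rintro _ ⟨b, rfl⟩
        have hcont : Continuous fun z : Z.carrier => z.1 1 :=
          (continuous_apply 1).comp continuous_subtype_val
        exact (isOpen_discrete {b}).preimage hcont
      · exact Set.eq_univ_of_forall fun z => ⟨_, ⟨z.1 1, rfl⟩, rfl⟩
    refine le_trans ?_ (le_iSup₂ (f := fun 𝒰 (_ : IsFiniteOpenCover 𝒰) => coverEntropy F 𝒰)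
      _ hcov)
    refine limsup_le_limsup (Eventually.of_forall fun n => ?_)
    refine EReal.div_le_div_right_of_nonneg (by positivity) (ENNReal.log_le_log ?_)
    rw [hrange, Nat.cast_le]
    refine ncard_range_le_minSubcover (coverJoin_finite hcov.finite _)
      (sUnion_coverJoin hcov.sUnion_eq _) _ ?_
    rintro _ ⟨c, hc, rfl⟩ x hx y hy
    funext g
    simp only [Set.mem_iInter, Set.mem_preimage] at hx hy
    have hx := hx g g.2
    have hy := hy g g.2
    obtain ⟨b, hb⟩ := hc g g.2
    rw [← hb] at hx hy
    simp only [cyl, Set.mem_ofPred_eq, GSubshift.smul_apply, one_mul] at hx hy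
    rw [hx, hy]

/-! ### Factors have smaller entropy -/

/-- Covers of `Y` pull back to `X`. By surjectivity, a subcover of the join of the pulled-back cover
yields one of the original join, no larger. -/
theorem IsFactorMap.topEntropy_le {G X Y : Type*} [Group G] [TopologicalSpace X]
    [MulAction G X] [TopologicalSpace Y] [MulAction G Y] {φ : X → Y} (hφ : IsFactorMap G φ)
    (F : ℕ → Finset G) : topEntropy F Y ≤ topEntropy F X := by
  classical
  refine iSup₂_le fun 𝒰 h𝒰 => ?_
  have h𝒱 : IsFiniteOpenCover ((φ ⁻¹' ·) '' 𝒰) := by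
    refine ⟨h𝒰.finite.image _, ?_, ?_⟩
    · rintro _ ⟨U, hU, rfl⟩
      exact (h𝒰.isOpen U hU).preimage hφ.continuous
    · refine Set.eq_univ_of_forall fun x => ?_
      have : φ x ∈ ⋃₀ 𝒰 := h𝒰.sUnion_eq ▸ Set.mem_univ _
      obtain ⟨U, hU, hx⟩ := this
      exact ⟨_, ⟨U, hU, rfl⟩, hx⟩
  refine le_trans ?_ (le_iSup₂ (f := fun 𝒰 (_ : IsFiniteOpenCover 𝒰) => coverEntropy F 𝒰)
    _ h𝒱)
  refine limsup_le_limsup (Eventually.of_forall fun n => ?_)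
  refine EReal.div_le_div_right_of_nonneg (by positivity) (ENNReal.log_le_log ?_)
  rw [Nat.cast_le]
  obtain ⟨s, hs, hsc, hcard⟩ := exists_card_eq_minSubcover
    (coverJoin_finite h𝒱.finite (F n)) (sUnion_coverJoin h𝒱.sUnion_eq (F n))
  rw [← hcard]
  have h : ∀ V ∈ s, ∃ V' ∈ coverJoin 𝒰 (F n), V ⊆ φ ⁻¹' V' := by
    intro V hV
    obtain ⟨c, hc, rfl⟩ := hs hV
    choose! c' hc' hcc' using hc
    refine ⟨_, ⟨c', hc', rfl⟩, fun x hx => ?_⟩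
    simp only [Set.mem_iInter, Set.mem_preimage] at hx ⊢
    intro g hg
    have := hx g hg
    rw [← hcc' g hg] at this
    rwa [← hφ.map_smul]
  choose! V' hV' hsub using h
  refine (minSubcover_le (s := s.image V') ?_ ?_).trans Finset.card_image_le
  · intro V hV
    obtain ⟨U, hU, rfl⟩ := Finset.mem_image.1 (Finset.mem_coe.1 hV)
    exact hV' U hU
  · refine Set.eq_univ_of_forall fun y => ?_
    obtain ⟨x, rfl⟩ := hφ.surjective y
    have : x ∈ ⋃₀ (s : Set (Set X)) := hsc ▸ Set.mem_univ _
    obtain ⟨V, hV, hx⟩ := this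
    exact ⟨V' V, by simpa using ⟨V, hV, rfl⟩, hsub V hV hx⟩

theorem coverEntropy_nonneg {G X : Type*} [Group G] [MulAction G X] [Nonempty X]
    [TopologicalSpace X] (F : ℕ → Finset G) {𝒰 : Set (Set X)} (h𝒰 : IsFiniteOpenCover 𝒰) :
    0 ≤ coverEntropy F 𝒰 := by
  have h0 : limsup (fun _ : ℕ => (0 : EReal)) atTop = 0 := limsup_const _
  rw [← h0]
  refine limsup_le_limsup (Eventually.of_forall fun n => ?_)
  refine EReal.div_nonneg (ENNReal.zero_le_log_iff.2 ?_) (by positivity)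
  obtain ⟨s, -, hsc, hcard⟩ := exists_card_eq_minSubcover
    (coverJoin_finite h𝒰.finite (F n)) (sUnion_coverJoin h𝒰.sUnion_eq (F n))
  rw [← hcard, Nat.one_le_cast, Nat.one_le_iff_ne_zero]
  intro h
  rw [Finset.card_eq_zero.1 h] at hsc
  simp only [Finset.coe_empty, Set.sUnion_empty] at hsc
  exact Set.empty_ne_univ hsc

theorem isFiniteOpenCover_univ (X : Type*) [TopologicalSpace X] :
    IsFiniteOpenCover ({Set.univ} : Set (Set X)) :=
  ⟨Set.finite_singleton _, by simp, by simp⟩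

theorem topEntropy_nonneg {G : Type*} [Group G] (F : ℕ → Finset G) (X : Type*)
    [TopologicalSpace X] [MulAction G X] [Nonempty X] : 0 ≤ topEntropy F X :=
  (coverEntropy_nonneg F (isFiniteOpenCover_univ X)).trans
    (le_iSup₂ (f := fun 𝒰 (_ : IsFiniteOpenCover 𝒰) => coverEntropy F 𝒰) _
      (isFiniteOpenCover_univ X))

theorem topEntropy_eq_bot {G : Type*} [Group G] {F : ℕ → Finset G}
    (hF : ∀ n, (F n).Nonempty) (X : Type*)
    [TopologicalSpace X] [MulAction G X] [IsEmpty X] : topEntropy F X = ⊥ := by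
  refine le_bot_iff.1 (iSup₂_le fun 𝒰 _ => ?_)
  have hb : limsup (fun _ : ℕ => (⊥ : EReal)) atTop = ⊥ := limsup_const _
  rw [← hb]
  refine limsup_le_limsup (Eventually.of_forall fun n => ?_)
  have h0 : minSubcover (coverJoin 𝒰 (F n)) = 0 :=
    Nat.le_zero.1 (minSubcover_le (s := ∅) (by simp) (Set.eq_univ_of_forall isEmptyElim))
  simp only [h0, Nat.cast_zero, ENNReal.log_zero]
  rw [EReal.bot_div_of_pos_ne_top (by exact_mod_cast (hF n).card_pos) (EReal.natCast_ne_top _)]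

/-! ### Masked factors -/

open scoped Classical in
/-- The configuration `x` seen only at the times at which it visits `C`. -/
noncomputable def GSubshift.mask {G A : Type*} [Group G] [TopologicalSpace A]
    (X : GSubshift G A) (C : Set X.carrier) (x : X.carrier) (g : G) : Option A :=
  if g • x ∈ C then some (x.1 g) else none

/-- The patterns on `S` of the masked configurations. -/
noncomputable def GSubshift.maskPattern {G A : Type*} [Group G] [TopologicalSpace A]
    (X : GSubshift G A) (C : Set X.carrier) (S : Finset G) (x : X.carrier) (g : S) : Option A :=
  X.mask C x g

section Mask

variable {G A : Type*} [Group G] [TopologicalSpace A] (X : GSubshift G A)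

theorem GSubshift.mask_of_mem {C : Set X.carrier} {x : X.carrier} {g : G} (h : g • x ∈ C) :
    X.mask C x g = some (x.1 g) := if_pos h

theorem GSubshift.mask_of_notMem {C : Set X.carrier} {x : X.carrier} {g : G} (h : g • x ∉ C) :
    X.mask C x g = none := if_neg h

theorem GSubshift.mask_ne_none_iff {C : Set X.carrier} {x : X.carrier} {g : G} :
    X.mask C x g ≠ none ↔ g • x ∈ C := by
  by_cases h : g • x ∈ C <;> simp [GSubshift.mask, h]

theorem GSubshift.mask_smul (C : Set X.carrier) (x : X.carrier) (g h : G) :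
    X.mask C (g • x) h = X.mask C x (h * g) := by
  have e : h • g • x = (h * g) • x := (mul_smul h g x).symm
  by_cases hC : (h * g) • x ∈ C
  · rw [X.mask_of_mem hC, X.mask_of_mem (e ▸ hC), GSubshift.smul_apply]
  · rw [X.mask_of_notMem hC, X.mask_of_notMem (e ▸ hC)]

theorem GSubshift.continuous_smul (g : G) : Continuous fun x : X.carrier => g • x := by
  refine Continuous.subtype_mk (continuous_pi fun h => ?_) _
  exact (continuous_apply (h * g)).comp continuous_subtype_val

/-- Clopenness of `C` is what makes masking continuous: the masked symbol is locally constant in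
`x`. -/
theorem GSubshift.isOpen_mask_preimage [DiscreteTopology A] {C : Set X.carrier}
    (hC : IsClopen C) (g : G) (s : Set (Option A)) :
    IsOpen ((fun x => X.mask C x g) ⁻¹' s) := by
  have happ : Continuous fun x : X.carrier => x.1 g :=
    (continuous_apply g).comp continuous_subtype_val
  have hC' : IsClopen {x : X.carrier | g • x ∈ C} := hC.preimage (X.continuous_smul g)
  have h1 : IsOpen {x : X.carrier | some (x.1 g) ∈ s} :=
    (isOpen_discrete {a : A | some a ∈ s}).preimage happ
  have : (fun x => X.mask C x g) ⁻¹' s =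
      ({x : X.carrier | g • x ∈ C} ∩ {x : X.carrier | some (x.1 g) ∈ s}) ∪
        ({x : X.carrier | g • x ∈ C}ᶜ ∩ {_x : X.carrier | none ∈ s}) := by
    ext x
    by_cases h : g • x ∈ C <;> simp [GSubshift.mask, h]
  rw [this]
  exact (hC'.isOpen.inter h1).union (hC'.compl.isOpen.inter isOpen_const)

variable {B : Type*} [TopologicalSpace B] [DiscreteTopology B]

/-- The factor of `X` recording the configurations at the times at which they visit `C`, with the
symbols of `Option A` encoded in `B`. -/
def GSubshift.maskFactor [DiscreteTopology A] [Finite A] (e : Option A ≃ B) {C : Set X.carrier}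
    (hC : IsClopen C) : GSubshift G B where
  carrier := Set.range fun (x : X.carrier) (g : G) => e (X.mask C x g)
  isClosed := (isCompact_range (continuous_pi fun g => continuous_def.2 fun s _ =>
    X.isOpen_mask_preimage hC g (e ⁻¹' s))).isClosed
  shift_mem := by
    rintro g _ ⟨x, rfl⟩
    exact ⟨g • x, funext fun h => congrArg e (X.mask_smul C x g h)⟩

theorem GSubshift.isFactorMap_maskFactor [DiscreteTopology A] [Finite A] (e : Option A ≃ B)
    {C : Set X.carrier} (hC : IsClopen C) :
    IsFactorMap G (Y := (X.maskFactor e hC).carrier)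
      (fun x => ⟨fun g => e (X.mask C x g), x, rfl⟩) where
  continuous := Continuous.subtype_mk (continuous_pi fun g => continuous_def.2 fun s _ =>
    X.isOpen_mask_preimage hC g (e ⁻¹' s)) _
  surjective := by
    rintro ⟨_, x, rfl⟩
    exact ⟨x, rfl⟩
  map_smul g x := Subtype.ext (funext fun h => congrArg e (X.mask_smul C x g h))

theorem GSubshift.patternCount_maskFactor [DiscreteTopology A] [Finite A] (e : Option A ≃ B)
    {C : Set X.carrier} (hC : IsClopen C) (S : Finset G) :
    patternCount (X.maskFactor e hC).carrier S = (Set.range (X.maskPattern C S)).ncard := by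
  have : (fun (z : G → B) (g : S) => z g) '' (X.maskFactor e hC).carrier =
      (fun p : S → Option A => e ∘ p) '' Set.range (X.maskPattern C S) := by
    rw [← Set.range_comp]
    change _ '' Set.range _ = _
    rw [← Set.range_comp]
    rfl
  rw [patternCount, this, Set.ncard_image_of_injective _ e.injective.comp_left]

/-- The exponential growth rate of the number of masked patterns. -/
noncomputable def GSubshift.maskEntropy (F : ℕ → Finset G) (C : Set X.carrier) : EReal :=
  limsup (fun n => ENNReal.log ((Set.range (X.maskPattern C (F n))).ncard : ENNReal) /
    ((F n).card : EReal)) atTop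

theorem GSubshift.entropy_maskFactor [DiscreteTopology A] [Finite A] {F : ℕ → Finset G}
    (hF : IsFolnerSeq F) (e : Option A ≃ B) {C : Set X.carrier} (hC : IsClopen C) :
    (X.maskFactor e hC).entropy F = X.maskEntropy F C := by
  have : Finite B := Finite.of_equiv _ e
  rw [GSubshift.entropy_eq_limsup hF, GSubshift.maskEntropy]
  simp only [GSubshift.patternCount_maskFactor]

theorem GSubshift.mem_factorEntropies_of_maskEntropy [DiscreteTopology A] [Finite A]
    {F : ℕ → Finset G} (hF : IsFolnerSeq F) {C : Set X.carrier} (hC : IsClopen C) {r : ℝ}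
    (hr : X.maskEntropy F C = r) : r ∈ X.factorEntropies F := by
  -- The alphabet is recoded because `factorEntropies` asks for one in `Type`, whereas `A` may live
  -- in any universe.
  let e : Option A ≃ Fin (Nat.card (Option A)) := Finite.equivFin _
  exact ⟨_, inferInstance, inferInstance, inferInstance, X.maskFactor e hC, _,
    X.isFactorMap_maskFactor e hC, (X.entropy_maskFactor hF e hC).trans hr⟩

theorem GSubshift.maskEntropy_univ [DiscreteTopology A] [Finite A] {F : ℕ → Finset G}
    (hF : IsFolnerSeq F) : X.maskEntropy F Set.univ = X.entropy F := by
  rw [GSubshift.entropy_eq_limsup hF, GSubshift.maskEntropy]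
  have : ∀ S, (Set.range (X.maskPattern Set.univ S)).ncard = patternCount X.carrier S := by
    intro S
    have : Set.range (X.maskPattern Set.univ S) =
        (fun p : S → A => some ∘ p) '' ((fun (z : G → A) (g : S) => z g) '' X.carrier) := by
      rw [Set.image_image, Set.image_eq_range]
      congr 1
      funext x g
      exact X.mask_of_mem (Set.mem_univ _)
    rw [this, Set.ncard_image_of_injective _ (Option.some_injective A).comp_left, patternCount]
  simp only [this]

theorem GSubshift.maskEntropy_empty (F : ℕ → Finset G) : X.maskEntropy F ∅ ≤ 0 := by
  have h0 : limsup (fun _ : ℕ => (0 : EReal)) atTop = 0 := limsup_const _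
  rw [← h0]
  refine limsup_le_limsup (Eventually.of_forall fun n => ?_)
  refine EReal.div_nonpos_of_nonpos_of_nonneg (ENNReal.log_le_zero_iff.2 ?_) (by positivity)
  rw [Nat.cast_le_one]
  have hsub : (Set.range (X.maskPattern ∅ (F n))).Subsingleton := by
    rintro _ ⟨x, rfl⟩ _ ⟨y, rfl⟩
    funext g
    exact (X.mask_of_notMem (Set.notMem_empty _)).trans
      (X.mask_of_notMem (Set.notMem_empty _)).symm
  exact (Set.ncard_le_one hsub.finite).2 fun _ ha _ hb => hsub ha hb

/-- If the patterns masked by `C'` are determined by those masked by `C` and by colourings whose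
support has pairwise disjoint translates of `K`, then the entropy grows little from `C` to
`C'`. -/
theorem GSubshift.maskEntropy_le_add_sparseRate [Finite A] {F : ℕ → Finset G}
    (hF : IsFolnerSeq F) (C C' : Set X.carrier) {K : Finset G} (hK : K.Nonempty)
    {Q : Type*} [Finite Q] {q : ℕ} (hq : 0 < q) (hQ : Nat.card Q ≤ q)
    (H : ∀ S : Finset G, ∃ ψ : X.carrier → S → Option Q,
      (∀ x s s', ψ x s ≠ none → ψ x s' ≠ none → ∀ k ∈ K, ∀ k' ∈ K,
        k * (s : G) = k' * s' → s = s') ∧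
      ∀ x x', X.maskPattern C S x = X.maskPattern C S x' → ψ x = ψ x' →
        X.maskPattern C' S x = X.maskPattern C' S x') :
    X.maskEntropy F C' ≤ X.maskEntropy F C + (sparseRate q K.card : EReal) := by
  classical
  have := Fintype.ofFinite Q
  refine limsup_log_div_le hF.card_pos _ ?_
  filter_upwards [hF.eventually_card_mul_le K] with n hn
  obtain ⟨ψ, hsep, hdet⟩ := H (F n)
  exact ncard_range_le_of_sparse hK hn hq (by rwa [← Nat.card_eq_fintype_card]) ψ hsep hdet

/-- Adding a set with disjoint translates to the mask. -/
theorem GSubshift.maskEntropy_union_le [Finite A] [Nonempty A] {F : ℕ → Finset G}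
    (hF : IsFolnerSeq F) (C D : Set X.carrier) {K : Finset G} (hK : K.Nonempty)
    (hD : ∀ x ∈ D, ∀ y ∈ D, ∀ k ∈ K, ∀ k' ∈ K, k • x = k' • y → k = k') :
    X.maskEntropy F (C ∪ D) ≤
      X.maskEntropy F C + (sparseRate (Nat.card A) K.card : EReal) := by
  refine X.maskEntropy_le_add_sparseRate hF C _ hK (Q := A) Nat.card_pos le_rfl fun S =>
    -- The mask of `D` itself serves as the sparse colouring.
    ⟨X.maskPattern D S, ?_, ?_⟩
  · intro x s s' hs hs' k hk k' hk' e
    have hs := X.mask_ne_none_iff.1 hs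
    have hs' := X.mask_ne_none_iff.1 hs'
    have hkk := hD _ hs _ hs' k hk k' hk' (by rw [← mul_smul, ← mul_smul, e])
    subst hkk
    exact Subtype.ext (mul_left_cancel e)
  · intro x x' hα hψ
    funext s
    have hα : X.mask C x s = X.mask C x' s := congrFun hα s
    have hψ : X.mask D x s = X.mask D x' s := congrFun hψ s
    change X.mask (C ∪ D) x s = X.mask (C ∪ D) x' s
    by_cases h1 : (s : G) • x ∈ C
    · have h1' := X.mask_ne_none_iff.2 h1
      rw [hα] at h1'
      have h2 := X.mask_ne_none_iff.1 h1'
      rwa [X.mask_of_mem (Or.inl h1), X.mask_of_mem (Or.inl h2), ← X.mask_of_mem h1,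
        ← X.mask_of_mem h2]
    by_cases h1d : (s : G) • x ∈ D
    · have h1' := X.mask_ne_none_iff.2 h1d
      rw [hψ] at h1'
      have h2 := X.mask_ne_none_iff.1 h1'
      rwa [X.mask_of_mem (Or.inr h1d), X.mask_of_mem (Or.inr h2), ← X.mask_of_mem h1d,
        ← X.mask_of_mem h2]
    · have h2 : (s : G) • x' ∉ C := fun h => X.mask_ne_none_iff.2 h
        (hα ▸ X.mask_of_notMem h1)
      have h2d : (s : G) • x' ∉ D := fun h => X.mask_ne_none_iff.2 h
        (hψ ▸ X.mask_of_notMem h1d)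
      rw [X.mask_of_notMem (by simp [h1, h1d]), X.mask_of_notMem (by simp [h2, h2d])]

/-! ### Points with small orbits -/

/-- The points of `X` whose orbit has at most `k` elements. -/
def GSubshift.smallOrbits (k : ℕ) : Set X.carrier :=
  {x | ∃ ι : Fin k → X.carrier, MulAction.orbit G x ⊆ Set.range ι}

/-- The patterns on `W` of the points with small orbits. -/
def GSubshift.smallPatterns (k : ℕ) (W : Finset G) : Set (W → A) :=
  (fun (x : X.carrier) (w : W) => x.1 w) '' X.smallOrbits k

/-- Since `x w = (w • x) 1`, the pattern can be read by walking through the orbit along a word in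
`T`. It is thus coded by a starting index, a self-map of the `k` indices for each generator and each
inverse, and the symbol at the identity of each indexed point; these give the three factors. -/
theorem GSubshift.ncard_smallPatterns_le [Finite A] (k : ℕ) {T W : Finset G}
    (hW : (W : Set G) ⊆ Subgroup.closure (T : Set G)) :
    (X.smallPatterns k W).ncard ≤ k * (k ^ k) ^ (2 * T.card) * Nat.card A ^ k := by
  classical
  let T' : Finset G := T ∪ T⁻¹
  have hT' : T'.card ≤ 2 * T.card := by
    refine (Finset.card_union_le _ _).trans ?_
    rw [Finset.card_inv]
    omega
  rcases Nat.eq_zero_or_pos k with rfl | hk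
  · have : X.smallPatterns 0 W = ∅ := by
      refine Set.image_eq_empty.2 (Set.eq_empty_of_forall_notMem ?_)
      rintro x ⟨ι, hι⟩
      obtain ⟨i, -⟩ := hι (MulAction.mem_orbit_self x)
      exact i.elim0
    simp [this]
  have hex : ∀ p : X.smallPatterns k W, ∃ d : Fin k × (T' → Fin k → Fin k) × (Fin k → A),
      ∃ (x : X.carrier) (ι : Fin k → X.carrier), (∀ w : W, x.1 w = p.1 w) ∧
        ι d.1 = x ∧ (∀ t i, (ι i ∈ MulAction.orbit G x) → ι (d.2.1 t i) = (t : G) • ι i) ∧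
        ∀ i, (ι i).1 1 = d.2.2 i := by
    rintro ⟨_, x, ⟨ι, hι⟩, rfl⟩
    have hi : ∀ y : X.carrier, ∃ i : Fin k, y ∈ MulAction.orbit G x → ι i = y := by
      intro y
      by_cases hy : y ∈ MulAction.orbit G x
      · obtain ⟨i, hi⟩ := hι hy
        exact ⟨i, fun _ => hi⟩
      · exact ⟨⟨0, hk⟩, fun h => absurd h hy⟩
    choose s hs using hi
    refine ⟨(s x, fun t i => s ((t : G) • ι i), fun i => (ι i).1 1), x, ι, fun w => rfl,
      hs _ (MulAction.mem_orbit_self x), fun t i h => hs _ ?_, fun i => rfl⟩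
    exact MulAction.mem_orbit_of_mem_orbit _ h
  choose d x ι hp hbase htr hval using hex
  have hinj : Function.Injective d := by
    intro p p' e
    -- Two points with the same code walk through the same indices.
    have key : ∀ h ∈ Subgroup.closure (T : Set G), ∃ i, ι p i = h • x p ∧ ι p' i = h • x p' := by
      have hstep : ∀ t ∈ T', ∀ h : G, (∃ i, ι p i = h • x p ∧ ι p' i = h • x p') →
          ∃ i, ι p i = (t * h) • x p ∧ ι p' i = (t * h) • x p' := by
        rintro t ht h ⟨i, hi, hi'⟩
        refine ⟨(d p).2.1 ⟨t, ht⟩ i, ?_, ?_⟩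
        · rw [htr p ⟨t, ht⟩ i (hi ▸ MulAction.mem_orbit _ _), hi, mul_smul]
        · rw [e, htr p' ⟨t, ht⟩ i (hi' ▸ MulAction.mem_orbit _ _), hi', mul_smul]
      intro h hh
      induction hh using Subgroup.closure_induction_left with
      | one => exact ⟨(d p).1, by rw [hbase, one_smul], by rw [e, hbase, one_smul]⟩
      | mul_left t ht h _ ih => exact hstep t (by simpa [T'] using Or.inl ht) h ih
      | inv_mul_cancel t ht h _ ih => exact hstep t⁻¹ (by simpa [T'] using Or.inr ht) h ih
    refine Subtype.ext (funext fun w => ?_)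
    obtain ⟨i, hi, hi'⟩ := key w (hW w.2)
    have h1 : (ι p i).1 1 = (ι p' i).1 1 := by rw [hval, hval, e]
    rw [hi, hi', GSubshift.smul_apply, GSubshift.smul_apply, one_mul] at h1
    rw [← hp p w, ← hp p' w, h1]
  have := Nat.card_le_card_of_injective d hinj
  rw [Nat.card_coe_set_eq] at this
  refine this.trans ?_
  rw [Nat.card_prod, Nat.card_prod, Nat.card_fun, Nat.card_fun, Nat.card_fun, Nat.card_fin,
    Nat.card_eq_finsetCard, ← mul_assoc]
  gcongr
  exact Nat.one_le_pow _ _ hk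

end Mask

/-! ### Neighbourhoods of small orbits and of the remaining points -/

section SmallOrbits

variable {G A : Type*} [Group G] [TopologicalSpace A] (X : GSubshift G A)

/-- The points that look on `W` like a point with a small orbit. -/
def GSubshift.nearSmallOrbits (k : ℕ) (W : Finset G) : Set X.carrier :=
  {x | (fun w : W => x.1 w) ∈ X.smallPatterns k W}

theorem GSubshift.smallOrbits_subset_near (k : ℕ) (W : Finset G) :
    X.smallOrbits k ⊆ X.nearSmallOrbits k W := fun x hx => ⟨x, hx, rfl⟩

theorem GSubshift.isClopen_nearSmallOrbits [DiscreteTopology A] (k : ℕ) (W : Finset G) :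
    IsClopen (X.nearSmallOrbits k W) :=
  (isClopen_discrete (X.smallPatterns k W)).preimage (continuous_pi fun w =>
    (continuous_apply (w : G)).comp continuous_subtype_val)

open scoped Classical in
/-- The visits of `x` to the points near small orbits are described by their patterns along a
maximal set of visits with disjoint translates of `W`. -/
theorem GSubshift.exists_sparse_colouring (k : ℕ) {W : Finset G} (hW : W.Nonempty)
    (S : Finset G) (x : X.carrier) :
    ∃ ψ : S → Option (X.smallPatterns k (W⁻¹ * W)),
      (∀ s s', ψ s ≠ none → ψ s' ≠ none → ∀ w ∈ W, ∀ w' ∈ W,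
        w * (s : G) = w' * s' → s = s') ∧
      (∀ s p, ψ s = some p → ∀ w, p.1 w = x.1 (w * s)) ∧
      ∀ s : S, (s : G) • x ∈ X.nearSmallOrbits k (W⁻¹ * W) →
        ∃ (s' : S) (w : (W⁻¹ * W : Finset G)), ψ s' ≠ none ∧ (w : G) * s' = s := by
  let P : Set (Finset S) := {I | (∀ s ∈ I, (s : G) • x ∈ X.nearSmallOrbits k (W⁻¹ * W)) ∧
    ∀ s ∈ I, ∀ s' ∈ I, ∀ w ∈ W, ∀ w' ∈ W, w * (s : G) = w' * s' → s = s'}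
  obtain ⟨I, -, hI⟩ := (Set.toFinite P).exists_le_maximal (a := ∅) ⟨by simp, by simp⟩
  have hmem : ∀ s ∈ I, (s : G) • x ∈ X.nearSmallOrbits k (W⁻¹ * W) := hI.prop.1
  let ψ : S → Option (X.smallPatterns k (W⁻¹ * W)) := fun s =>
    if h : s ∈ I then some ⟨_, hmem s h⟩ else none
  have hψ : ∀ s, ψ s ≠ none ↔ s ∈ I := fun s => by
    by_cases h : s ∈ I <;> simp [ψ, h]
  refine ⟨ψ, fun s s' hs hs' => hI.prop.2 s ((hψ s).1 hs) s' ((hψ s').1 hs'), ?_, ?_⟩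
  · intro s p hp w
    have h : s ∈ I := (hψ s).1 (by rw [hp]; simp)
    simp only [ψ, h, dif_pos, Option.some.injEq] at hp
    rw [← hp]
    rfl
  · intro s hs
    suffices h : ∃ s' ∈ I, ∃ w ∈ W, ∃ w' ∈ W, w * (s : G) = w' * s' by
      obtain ⟨s', hs', w, hw, w', hw', e⟩ := h
      refine ⟨s', ⟨w⁻¹ * w', Finset.mul_mem_mul (Finset.inv_mem_inv hw) hw'⟩,
        (hψ s').2 hs', ?_⟩
      change w⁻¹ * w' * (s' : G) = s
      rw [mul_assoc, ← e, inv_mul_cancel_left]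
    by_cases hsI : s ∈ I
    · obtain ⟨w, hw⟩ := hW
      exact ⟨s, hsI, w, hw, w, hw, rfl⟩
    by_contra! hne
    refine hsI (hI.le_of_ge (y := insert s I) ⟨?_, ?_⟩ (Finset.subset_insert _ _)
      (Finset.mem_insert_self _ _))
    · intro s' hs'
      rcases Finset.mem_insert.1 hs' with rfl | h
      exacts [hs, hmem _ h]
    · intro s₁ h₁ s₂ h₂ w hw w' hw' e
      rcases Finset.mem_insert.1 h₁ with rfl | h₁' <;> rcases Finset.mem_insert.1 h₂ with rfl | h₂'
      · rfl
      · exact absurd e (hne _ h₂' w hw w' hw')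
      · exact absurd e.symm (hne _ h₁' w' hw' w hw)
      · exact hI.prop.2 _ h₁' _ h₂' w hw w' hw' e

open scoped Classical in
/-- Unmasking the points near small orbits increases the entropy little. -/
theorem GSubshift.maskEntropy_univ_le [Finite A] {F : ℕ → Finset G}
    (hF : IsFolnerSeq F) (k : ℕ) {W : Finset G} (hW : W.Nonempty) {q : ℕ} (hq : 0 < q)
    (hQ : (X.smallPatterns k (W⁻¹ * W)).ncard ≤ q) :
    X.maskEntropy F Set.univ ≤
      X.maskEntropy F (X.nearSmallOrbits k (W⁻¹ * W))ᶜ + (sparseRate q W.card : EReal) := by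
  refine X.maskEntropy_le_add_sparseRate hF _ _ hW (Q := X.smallPatterns k (W⁻¹ * W)) hq
    (by rwa [Nat.card_coe_set_eq]) fun S => ?_
  choose ψ hsep hval hcov using X.exists_sparse_colouring k hW S
  refine ⟨ψ, hsep, fun x x' hα hψ => funext fun s => ?_⟩
  have hα : X.mask _ x s = X.mask _ x' s := congrFun hα s
  change X.mask Set.univ x s = X.mask Set.univ x' s
  rw [X.mask_of_mem (Set.mem_univ _), X.mask_of_mem (Set.mem_univ _)]
  by_cases h : (s : G) • x ∈ X.nearSmallOrbits k (W⁻¹ * W)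
  · obtain ⟨s', w, hs', e⟩ := hcov x s h
    obtain ⟨p, hp⟩ := Option.ne_none_iff_exists'.1 hs'
    -- A symbol near a small orbit is read off the pattern stored at the nearby coloured position
    -- `s'`.
    rw [← e, ← hval x s' p hp w, ← hval x' s' p (hψ ▸ hp) w]
  · have h1 := X.mask_ne_none_iff.2 (show (s : G) • x ∈ (X.nearSmallOrbits k (W⁻¹ * W))ᶜ from h)
    rw [hα] at h1
    have h2 := X.mask_ne_none_iff.1 h1
    rwa [X.mask_of_mem (show (s : G) • x ∈ (X.nearSmallOrbits k (W⁻¹ * W))ᶜ from h),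
      X.mask_of_mem h2] at hα

theorem GSubshift.exists_injOn_of_notMem_smallOrbits {k : ℕ} {x : X.carrier}
    (hx : x ∉ X.smallOrbits k) :
    ∃ K : Finset G, K.card = k ∧ Set.InjOn (fun g : G => g • x) K := by
  classical
  have hcard : (k : ℕ∞) ≤ (MulAction.orbit G x).encard := by
    by_contra! h
    refine hx ?_
    obtain ⟨hfin, hle⟩ := Set.encard_le_coe_iff_finite_ncard_le.1 h.le
    have := hfin.to_subtype
    let e := Finite.equivFin (MulAction.orbit G x)
    refine ⟨fun i => if h : i.1 < Nat.card (MulAction.orbit G x) then (e.symm ⟨i, h⟩).1 else x,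
      fun y hy => ?_⟩
    have hlt := (e ⟨y, hy⟩).2
    rw [← Nat.card_coe_set_eq] at hle
    refine ⟨⟨(e ⟨y, hy⟩).1, hlt.trans_le hle⟩, ?_⟩
    simp only [hlt, dif_pos]
    exact congrArg Subtype.val (e.symm_apply_apply ⟨y, hy⟩)
  obtain ⟨O, hO, hOc⟩ := Set.exists_subset_encard_eq hcard
  have hfin : O.Finite := Set.finite_of_encard_eq_coe hOc
  have hn : O.ncard = k := by rw [Set.ncard_def, hOc, ENat.toNat_natCast]
  have hex : ∀ y : X.carrier, ∃ g : G, y ∈ O → g • x = y := fun y => by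
    by_cases hy : y ∈ O
    · obtain ⟨g, hg⟩ := hO hy
      exact ⟨g, fun _ => hg⟩
    · exact ⟨1, fun h => absurd h hy⟩
  choose γ hγ using hex
  refine ⟨hfin.toFinset.image γ, ?_, ?_⟩
  · rw [Finset.card_image_of_injOn, ← Set.ncard_eq_toFinset_card O hfin, hn]
    intro y hy y' hy' e
    simp only [Set.Finite.coe_toFinset] at hy hy'
    rw [← hγ y hy, ← hγ y' hy', e]
  · intro g hg g' hg' e
    simp only [Finset.coe_image, Set.Finite.coe_toFinset, Set.mem_image] at hg hg'
    obtain ⟨y, hy, rfl⟩ := hg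
    obtain ⟨y', hy', rfl⟩ := hg'
    simp only [hγ y hy, hγ y' hy'] at e
    rw [e]

/-- A point on whose orbit map `K` is injective has a clopen neighbourhood with disjoint
translates by `K`. -/
theorem GSubshift.exists_isClopen_separated [DiscreteTopology A] {x : X.carrier} {K : Finset G}
    (hK : Set.InjOn (fun g : G => g • x) K) :
    ∃ D : Set X.carrier, IsClopen D ∧ x ∈ D ∧
      ∀ y ∈ D, ∀ z ∈ D, ∀ k ∈ K, ∀ k' ∈ K, k • y = k' • z → k = k' := by
  classical
  -- `η (k, k')` is a coordinate distinguishing `k • x` from `k' • x`. Points of `D` imitate `x` at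
  -- all these coordinates, so they inherit the distinction.
  have hex : ∀ p : G × G, ∃ h : G, p.1 • x ≠ p.2 • x → (p.1 • x).1 h ≠ (p.2 • x).1 h := by
    intro p
    by_cases hp : p.1 • x = p.2 • x
    · exact ⟨1, fun h => absurd hp h⟩
    · have : (p.1 • x).1 ≠ (p.2 • x).1 := fun h => hp (Subtype.ext h)
      obtain ⟨h, hh⟩ := Function.ne_iff.1 this
      exact ⟨h, fun _ => hh⟩
  choose η hη using hex
  let D : Set X.carrier := ⋂ p ∈ K ×ˢ K, ⋂ k ∈ K,
    {y | (k • y).1 (η p) = (k • x).1 (η p)}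
  refine ⟨D, ?_, ?_, ?_⟩
  · refine isClopen_biInter_finset fun p _ => isClopen_biInter_finset fun k _ => ?_
    have hcont : Continuous fun y : X.carrier => y.1 (η p * k) :=
      (continuous_apply (η p * k)).comp continuous_subtype_val
    exact (isClopen_discrete {(k • x).1 (η p)}).preimage hcont
  · simp [D]
  · intro y hy z hz k hk k' hk' e
    by_contra hne
    have hne' : k • x ≠ k' • x := fun h => hne (hK hk hk' h)
    simp only [D, Set.mem_iInter, Set.mem_ofPred_eq] at hy hz
    have h1 := hy (k, k') (Finset.mk_mem_product hk hk') k hk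
    have h2 := hz (k, k') (Finset.mk_mem_product hk hk') k' hk'
    exact hη (k, k') hne' (by rw [← h1, ← h2, e])

end SmallOrbits

/-! ### Density of the entropies of the masked factors -/

theorem tendsto_sparseRate {q : ℕ} (hq : 0 < q) :
    Tendsto (fun M : ℕ => sparseRate q M) atTop (𝓝 0) := by
  have h1 : Tendsto (fun M : ℕ => Real.log M / (M : ℝ)) atTop (𝓝 0) :=
    (Real.isLittleO_log_id_atTop.tendsto_div_nhds_zero).comp tendsto_natCast_atTop_atTop
  have h2 : Tendsto (fun M : ℕ => (1 + 2 * Real.log q) / (M : ℝ)) atTop (𝓝 0) :=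
    tendsto_const_div_atTop_nhds_zero_nat _
  have h3 := h2.add (h1.const_mul 2)
  rw [mul_zero, add_zero] at h3
  refine h3.congr' ((eventually_gt_atTop 0).mono fun M hM => ?_)
  have hM' : (M : ℝ) ≠ 0 := by exact_mod_cast hM.ne'
  have hq' : (q : ℝ) ≠ 0 := by exact_mod_cast hq.ne'
  simp only [sparseRate, Real.log_mul hq' hM']
  ring

/-- Colourings by patterns of points with small orbits have small rate when the window is large
compared to the number of generators. -/
theorem exists_sparseRate_le (G : Type*) [Group G] [Infinite G] {a k : ℕ} (ha : 0 < a)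
    (hk : 0 < k) {ε : ℝ} (hε : 0 < ε) :
    ∃ T W : Finset G, (W : Set G) ⊆ Subgroup.closure (T : Set G) ∧ W.Nonempty ∧
      sparseRate (k * (k ^ k) ^ (2 * T.card) * a ^ k) W.card ≤ ε := by
  have ha' : (0 : ℝ) < a := by exact_mod_cast ha
  have hk' : (0 : ℝ) < k := by exact_mod_cast hk
  have hla : 0 ≤ Real.log a := Real.log_natCast_nonneg _
  have hlk : 0 ≤ Real.log k := Real.log_natCast_nonneg _
  obtain ⟨N₀, hN₀⟩ := eventually_atTop.1
    ((tendsto_sparseRate one_pos).eventually_le_const (half_pos hε))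
  -- `c` is chosen so that the logarithm of the number of colours is at most `c (|T| + 1)`. Then
  -- `N₁` makes its share of the rate at most `ε / 2`, and `N₀` does the same for the remaining `(1
  -- + 2 log |W|) / |W|`.
  set c : ℝ := Real.log k + 2 * (k * Real.log k) + k * Real.log a
  have hc : 0 ≤ c := by positivity
  obtain ⟨N₁, hN₁⟩ := exists_nat_ge (4 * c / ε)
  obtain ⟨T, W, hW, hcard⟩ := exists_finset_subset_closure G (N₀ + N₁ + 1)
  have hcard₀ : N₀ + N₁ + 1 ≤ W.card := le_trans (Nat.le_mul_of_pos_right _ (by omega)) hcard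
  have hWpos : 0 < W.card := by omega
  refine ⟨T, W, hW, Finset.card_pos.1 hWpos, ?_⟩
  have hW' : (0 : ℝ) < W.card := by exact_mod_cast hWpos
  have h1 := hN₀ W.card (by omega)
  have hlog : Real.log ((k * (k ^ k) ^ (2 * T.card) * a ^ k : ℕ) : ℝ) ≤ c * (T.card + 1) := by
    push_cast
    rw [Real.log_mul (by positivity) (by positivity), Real.log_mul (by positivity)
      (by positivity), Real.log_pow, Real.log_pow, Real.log_pow]
    push_cast
    have h3 : 0 ≤ (T.card : ℝ) * Real.log k := by positivity
    have h4 : 0 ≤ (T.card : ℝ) * (k * Real.log a) := by positivity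
    have h5 : 0 ≤ k * Real.log k := by positivity
    simp only [c]
    nlinarith
  have h2 : 4 * (c * (T.card + 1)) ≤ ε * W.card := by
    rw [div_le_iff₀ hε] at hN₁
    have h3 : ((N₀ + N₁ + 1 : ℕ) : ℝ) * (T.card + 1) ≤ W.card := by exact_mod_cast hcard
    have h4 : (N₁ : ℝ) * (T.card + 1) ≤ W.card := by
      refine le_trans ?_ h3
      gcongr
      omega
    calc 4 * (c * (T.card + 1)) = 4 * c * (T.card + 1) := by ring
      _ ≤ N₁ * ε * (T.card + 1) := by gcongr
      _ = ε * (N₁ * (T.card + 1)) := by ring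
      _ ≤ ε * W.card := by gcongr
  rw [sparseRate, Nat.cast_one, one_mul, div_le_iff₀ hW'] at h1
  rw [sparseRate, Real.log_mul (by positivity) hW'.ne', div_le_iff₀ hW']
  nlinarith

/-! ### Climbing from the empty mask to the full one -/

section Density

variable {G A : Type*} [Group G] [TopologicalSpace A] (X : GSubshift G A)

/-- The levels up to the entropy of the mask `C` are attained up to `ε` by clopen masks. -/
def GSubshift.IsDenseBelow (F : ℕ → Finset G) (ε : ℝ) (C : Set X.carrier) : Prop :=
  ∀ r : ℝ, 0 ≤ r → (r : EReal) ≤ X.maskEntropy F C →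
    ∃ C' : Set X.carrier, IsClopen C' ∧ (r : EReal) ≤ X.maskEntropy F C' ∧
      X.maskEntropy F C' ≤ ((r + ε : ℝ) : EReal)

theorem GSubshift.isDenseBelow_empty (F : ℕ → Finset G) {ε : ℝ} (hε : 0 < ε) :
    X.IsDenseBelow F ε ∅ := by
  intro r hr hrC
  refine ⟨∅, isClopen_empty, hrC, (X.maskEntropy_empty F).trans ?_⟩
  exact_mod_cast (by linarith : (0 : ℝ) ≤ r + ε)

variable {X} in
-- Levels up to the entropy of `C` are already served; any level in the new gap is within `δ` of the
-- entropy of `C'` itself.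
theorem GSubshift.IsDenseBelow.of_le_add {F : ℕ → Finset G} {ε δ : ℝ} {C C' : Set X.carrier}
    (h : X.IsDenseBelow F ε C) (hC' : IsClopen C') (hδ : δ ≤ ε)
    (hle : X.maskEntropy F C' ≤ X.maskEntropy F C + (δ : EReal)) :
    X.IsDenseBelow F ε C' := by
  intro r hr hrC'
  rcases le_or_gt (r : EReal) (X.maskEntropy F C) with hrC | hrC
  · exact h r hr hrC
  · refine ⟨C', hC', hrC', hle.trans ?_⟩
    rw [EReal.coe_add]
    exact add_le_add hrC.le (by exact_mod_cast hδ)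

/-- The order of choices matters: `k` first, so that separated sets are cheap; then `T` and `W`
depending on `k`, so that small orbits are cheap. The number of separated sets is irrelevant, since
only the single steps must be small. -/
theorem GSubshift.isDenseBelow_univ [Infinite G] [DiscreteTopology A] [Finite A]
    [Nonempty A] {F : ℕ → Finset G} (hF : IsFolnerSeq F) {ε : ℝ} (hε : 0 < ε) :
    X.IsDenseBelow F ε Set.univ := by
  classical
  obtain ⟨k, hkε, hk⟩ := (((tendsto_sparseRate (Nat.card_pos (α := A))).eventually_le_const
    hε).and (eventually_gt_atTop 0)).exists
  obtain ⟨T, W, hWT, hW, hrate⟩ :=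
    exists_sparseRate_le G (Nat.card_pos (α := A)) hk hε
  set U := X.nearSmallOrbits k (W⁻¹ * W) with hUdef
  have hU : IsClopen U := X.isClopen_nearSmallOrbits k _
  -- The stored patterns live on `W⁻¹ * W`, but their number depends only on `k`, `|T|` and `|A|`,
  -- so this larger window costs nothing.
  have hWW : ((W⁻¹ * W : Finset G) : Set G) ⊆ Subgroup.closure (T : Set G) := by
    intro g hg
    obtain ⟨u, hu, v, hv, rfl⟩ := Finset.mem_mul.1 (Finset.mem_coe.1 hg)
    have := inv_mem (hWT (Finset.mem_inv'.1 hu))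
    rw [inv_inv] at this
    exact mul_mem this (hWT hv)
  refine GSubshift.IsDenseBelow.of_le_add (C := Uᶜ) ?_ isClopen_univ hrate
    (X.maskEntropy_univ_le hF k hW (by have := Nat.card_pos (α := A); positivity)
      (X.ncard_smallPatterns_le k hWW))
  have hex : ∀ x : X.carrier, ∃ D : Set X.carrier, IsClopen D ∧ (x ∈ Uᶜ → x ∈ D) ∧
      ∃ K : Finset G, K.card = k ∧
        ∀ y ∈ D, ∀ z ∈ D, ∀ g ∈ K, ∀ g' ∈ K, g • y = g' • z → g = g' := by
    intro x
    by_cases hx : x ∈ U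
    · obtain ⟨K, hK⟩ := Infinite.exists_subset_card_eq G k
      -- Points of `U` need no neighbourhood here; an arbitrary `K` of size `k` keeps the step size
      -- uniform.
      exact ⟨∅, isClopen_empty, fun h => absurd hx h, K, hK, by simp⟩
    · obtain ⟨K, hKc, hK⟩ := X.exists_injOn_of_notMem_smallOrbits
        (fun h => hx (X.smallOrbits_subset_near k _ h))
      obtain ⟨D, hD, hxD, hsep⟩ := X.exists_isClopen_separated hK
      exact ⟨D, hD, fun _ => hxD, K, hKc, hsep⟩
  choose D hD hxD K hKc hsep using hex
  obtain ⟨t, ht⟩ := hU.compl.isClosed.isCompact.elim_finite_subcover D (fun x => (hD x).isOpen)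
    (fun x hx => Set.mem_iUnion.2 ⟨x, hxD x hx⟩)
  have key : ∀ t : Finset X.carrier, IsClopen (Uᶜ ∩ ⋃ x ∈ t, D x) ∧
      X.IsDenseBelow F ε (Uᶜ ∩ ⋃ x ∈ t, D x) := by
    intro t
    induction t using Finset.induction_on with
    | empty => simpa using ⟨isClopen_empty, X.isDenseBelow_empty F hε⟩
    | insert x t _ ih =>
      have hunion : Uᶜ ∩ ⋃ y ∈ insert x t, D y = (Uᶜ ∩ ⋃ y ∈ t, D y) ∪ (Uᶜ ∩ D x) := by
        rw [Finset.set_biUnion_insert, Set.inter_union_distrib_left, Set.union_comm]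
      have hcl : IsClopen (Uᶜ ∩ ⋃ y ∈ insert x t, D y) := by
        rw [hunion]
        exact ih.1.union (hU.compl.inter (hD x))
      refine ⟨hcl, ih.2.of_le_add hcl (δ := sparseRate (Nat.card A) (K x).card)
        (by rwa [hKc]) ?_⟩
      rw [hunion]
      exact X.maskEntropy_union_le hF _ _ (Finset.card_pos.1 (by rwa [hKc]))
        fun y hy z hz => hsep x y hy.2 z hz.2
  have := (key t).2
  rwa [Set.inter_eq_left.2 ht] at this

end Density

theorem theorem1p1 {G : Type*} [Group G] [Countable G] [Infinite G]
    (F : ℕ → Finset G) (hF : IsFolnerSeq F)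
    {A : Type*} [Finite A] [TopologicalSpace A] [DiscreteTopology A] (X : GSubshift G A) :
    X.factorEntropies F ⊆ {r : ℝ | (r : EReal) ∈ Set.Icc 0 (X.entropy F)} ∧
      {r : ℝ | (r : EReal) ∈ Set.Icc 0 (X.entropy F)} ⊆ closure (X.factorEntropies F) := by
  constructor
  · rintro r ⟨B, _, _, _, Z, φ, hφ, hr⟩
    refine ⟨?_, hr ▸ hφ.topEntropy_le F⟩
    rw [← hr]
    rcases isEmpty_or_nonempty Z.carrier with hZ | hZ
    -- The empty subshift has entropy `⊥`, which is not real, so it contributes no value.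
    · have hbot : Z.entropy F = ⊥ := topEntropy_eq_bot hF.nonempty _
      exact absurd (hr.symm.trans hbot) (EReal.coe_ne_bot r)
    · exact topEntropy_nonneg F _
  · rintro r ⟨hr0, hrX⟩
    rcases isEmpty_or_nonempty X.carrier with hX | ⟨⟨x⟩⟩
    · have hbot : X.entropy F = ⊥ := topEntropy_eq_bot hF.nonempty _
      exact absurd (le_bot_iff.1 (hbot ▸ hrX)) (EReal.coe_ne_bot r)
    have : Nonempty A := ⟨x.1 1⟩
    have hr0' : 0 ≤ r := by exact_mod_cast hr0
    refine Metric.mem_closure_iff.2 fun ε hε => ?_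
    obtain ⟨C, hC, hle, hge⟩ := X.isDenseBelow_univ hF (half_pos hε) r hr0'
      (by rwa [X.maskEntropy_univ hF])
    -- The mask entropy lies between two real numbers, hence is itself real.
    have hcoe : X.maskEntropy F C = ((X.maskEntropy F C).toReal : EReal) :=
      (EReal.coe_toReal (ne_top_of_le_ne_top (EReal.coe_ne_top _) hge)
        (ne_bot_of_le_ne_bot (EReal.coe_ne_bot _) hle)).symm
    refine ⟨_, X.mem_factorEntropies_of_maskEntropy hF hC hcoe, ?_⟩
    rw [hcoe, EReal.coe_le_coe_iff] at hle hge
    rw [Real.dist_eq, abs_lt]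
    constructor <;> linarith
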